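/- The VC-dimension of a finite set system $\mathcal F$ on a finite ground set $V$ is the largest size of a set $S\subseteq V$ such that every $B\subseteq S$ has the form $B=A\cap S$ with $A\in\mathcal F$. The dual of $\mathcal F$ is the set system $\mathcal F^*=\{\{A\in\mathcal F: v\in A\}: v\in V\}$ on the ground set $\mathcal F$, and the dual VC-dimension of $\mathcal F$ is the VC-dimension of $\mathcal F^*$. (The VC-dimension of an empty set system is taken to be $0$.) For an $m$-coloring $\chi$ of the edges of the complete graph $K_n$ with vertex set $V$, let $N_i(v)$ be the set of vertices joined to $v$ by an edge of color $i$; the VC-dimension and the dual VC-dimension of $\chi$ are those of the set system $\{N_i(v): 1\le i\le m,\ v\in V\}$. Let $r_d(k;m)$ (respectively $r^{\mathrm{VC}}_d(k;m)$) be the smallest integer $n$ such that every $m$-coloring of the edges of $K_n$ with dual VC-dimension (respectively VC-dimension) at most $d$ contains a monochromatic $K_k$, with the value $\infty$ if there is no such $n$. **Theorem 1.** (a) For all integers $k\ge 3$ and $d\ge 2$ there is a positive integer $c=c(k,d)$ such that for every $m\ge 1$ we have $r_d(k;m)\le 2^{cm}$, and every $m$-coloring of the edges of the complete graph on $2^{cm}$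 vertices with dual VC-dimension at most $d$ contains a monochromatic $K_k$. (b) Consequently, Erdős's conjecture $r(3;m)=2^{\Theta(m)}$ holds for colorings of bounded VC-dimension: for every integer $d\ge 2$ there is a positive integer $c=c(d)$ such that for every $m\ge 1$, $$2^m< r_d(3;m)\le 2^{cm}\qquad\text{and}\qquad 2^m< r^{\mathrm{VC}}_d(3;m)\le 2^{cm}.$$ -/

import Mathlib

namespace SchurErdos

/-- The dual of a set system `F` on `V`: its ground set is `F` (a set of subsets of `V`), and its
members are the sets `{A ∈ F | v ∈ A}` for `v ∈ V`. As every member is a subset of `F`, only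
subsets of `F` can be shattered. -/
def dualSystem {V : Type*} [Fintype V] [DecidableEq V] (F : Finset (Finset V)) :
    Finset (Finset (Finset V)) :=
  Finset.univ.image fun v : V => F.filter fun A => v ∈ A

/-- The dual VC-dimension of a set system: the VC-dimension of its dual. -/
def dualVCDim {V : Type*} [Fintype V] [DecidableEq V] (F : Finset (Finset V)) : ℕ :=
  (dualSystem F).vcDim

/-- An `m`-coloring of the edges of the complete graph on the `n` vertices `Fin n`. -/
abbrev Coloring (n m : ℕ) : Type := SimpleGraph.TopEdgeLabeling (Fin n) (Fin m)

/-- The set system `{N_i(v) : i a color, v a vertex}` of a coloring, where `N_i(v)` is the set of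
all vertices that are joined to `v` by an edge of color `i`. -/
def nbhdSystem {n m : ℕ} (χ : Coloring n m) : Finset (Finset (Fin n)) :=
  Finset.univ.image fun p : Fin m × Fin n => (χ.labelGraph p.1).neighborFinset p.2

/-- Some `k` vertices are pairwise joined by edges of one and the same color. -/
def HasMonoClique {n m : ℕ} (χ : Coloring n m) (k : ℕ) : Prop :=
  ∃ (i : Fin m) (S : Finset (Fin n)), (χ.labelGraph i).IsNClique k S

/-- `r_d(k; m)`: the smallest `n` such that every `m`-coloring of the edges of `K_n` with dual
VC-dimension at most `d` contains a monochromatic `K_k`; it is `⊤` if there is no such `n`. -/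
noncomputable def ramseyDualVC (d k m : ℕ) : ℕ∞ :=
  ⨅ n ∈ {n : ℕ | ∀ χ : Coloring n m, dualVCDim (nbhdSystem χ) ≤ d → HasMonoClique χ k}, (n : ℕ∞)

/-- The analogue of `ramseyDualVC` for the colorings with VC-dimension at most `d`. -/
noncomputable def ramseyVC (d k m : ℕ) : ℕ∞ :=
  ⨅ n ∈ {n : ℕ | ∀ χ : Coloring n m, (nbhdSystem χ).vcDim ≤ d → HasMonoClique χ k}, (n : ℕ∞)

end SchurErdos

namespace SchurErdos
open Finset

/-! If a vertex of U is joined in color i to all of S ⊆ U, passing from U to S lowers the clique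
bound of color i by one. So it suffices to find a nonempty set T of colors, each dominating one
common S in this way, with |U| ≤ C^|T| |S| and C depending only on d (`exists_dominated`); induction
on the sum of the clique bounds finishes.

To find T and S, give each vertex a list of l colors such that the lists miss at most a fraction 1/l
of the pairs. For l = 2^t, `HasLists.shorten` either cuts the lists to length t, or finds O(t²)
vertices whose listed colors reach many vertices in at least t colors. By Sauer-Shelah for the dual
system, the reached vertices show a number of patterns polynomial in 2^t, so a large set shares one
pattern: t colors dominate it, at a loss exponential in t. Descending a tower of twos to length 16
leaves one dominating color at constant loss.

VC-dimension d forces dual VC-dimension at most 2^(d+1), which transfers the upper bound. For the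
lower bound, color m-bit integers by their highest differing digit: neighborhoods are dyadic blocks,
hence laminar, and there is no triangle. -/

theorem sum_choose_le_pow (g d : ℕ) : ∑ k ∈ range (d + 1), g.choose k ≤ (g + 1) ^ d := by
  induction d with
  | zero => simp
  | succ d ih =>
    rw [sum_range_succ]
    have h1 : g.choose (d + 1) ≤ g * (g + 1) ^ d := by
      refine (Nat.choose_le_pow g (d + 1)).trans ?_
      rw [pow_succ, mul_comm]
      gcongr
      omega
    calc _ ≤ (g + 1) ^ d + g * (g + 1) ^ d := add_le_add ih h1
      _ = _ := by ring

/-- The **Sauer-Shelah lemma** for the trace of a set system on a finite set. -/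
theorem card_trace_le {α : Type*} [DecidableEq α] (𝒜 : Finset (Finset α)) (s : Finset α) {d : ℕ}
    (hd : 𝒜.vcDim ≤ d) : #(𝒜.image fun A => s ∩ A) ≤ (#s + 1) ^ d := by
  refine (card_le_card_shatterer _).trans (le_trans ?_ (sum_choose_le_pow #s d))
  simp_rw [← card_powersetCard]
  refine (card_le_card fun t ht => ?_).trans card_biUnion_le
  have ht' := mem_shatterer.1 ht
  have hts : t ⊆ s := by
    obtain ⟨u, hu, htu⟩ := ht'.exists_superset
    obtain ⟨A, -, rfl⟩ := mem_image.1 hu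
    exact htu.trans inter_subset_left
  have h𝒜 : 𝒜.Shatters t := by
    intro u hu
    obtain ⟨x, hx, rfl⟩ := ht' hu
    obtain ⟨A, hA, rfl⟩ := mem_image.1 hx
    exact ⟨A, hA, by rw [← inter_assoc, inter_eq_left.2 hts]⟩
  refine mem_biUnion.2 ⟨#t, mem_range.2 ?_, mem_powersetCard.2 ⟨hts, rfl⟩⟩
  have := h𝒜.card_le_vcDim
  omega

theorem vcDim_le_of_forall {α : Type*} [DecidableEq α] {𝒜 : Finset (Finset α)} {d : ℕ}
    (h : ∀ s, 𝒜.Shatters s → #s ≤ d) : 𝒜.vcDim ≤ d :=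
  Finset.sup_le fun s hs => h s (mem_shatterer.1 hs)

/-! ### Dual VC-dimension and laminar systems. -/

section Dual
variable {V : Type*} [Fintype V] [DecidableEq V]

/-- A set shattered by the dual system consists of members whose incidence patterns are
arbitrary. -/
theorem exists_mem_iff_of_dualSystem_shatters {F s : Finset (Finset V)}
    (hs : (dualSystem F).Shatters s) : s ⊆ F ∧ ∀ t ⊆ s, ∃ v, ∀ A ∈ s, v ∈ A ↔ A ∈ t := by
  have key : ∀ t ⊆ s, ∃ v, s ∩ F.filter (fun A => v ∈ A) = t := fun t ht => by
    obtain ⟨u, hu, h⟩ := hs ht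
    obtain ⟨v, -, rfl⟩ := mem_image.1 hu
    exact ⟨v, h⟩
  have hF : s ⊆ F := by
    obtain ⟨v, hv⟩ := key s Subset.rfl
    exact (inter_eq_left.1 hv).trans (filter_subset _ _)
  refine ⟨hF, fun t ht => ?_⟩
  obtain ⟨v, rfl⟩ := key t ht
  refine ⟨v, fun A hA => ?_⟩
  simp [hA, hF hA]

/-- The dual VC-dimension is at most exponential in the VC-dimension. -/
theorem dualVCDim_le_two_pow {F : Finset (Finset V)} {d : ℕ} (hd : F.vcDim ≤ d) :
    dualVCDim F ≤ 2 ^ (d + 1) := by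
  refine vcDim_le_of_forall fun s hs => ?_
  by_contra! hcard
  obtain ⟨hF, hv⟩ := exists_mem_iff_of_dualSystem_shatters hs
  -- Members of `s` are indexed by subsets of d + 1 points; the dual pattern "all B containing j" is
  -- realized by a vertex `v j`, and these d + 1 vertices are shattered by `F`.
  obtain ⟨e⟩ : Nonempty (Finset (Fin (d + 1)) ↪ s) := by
    rw [Function.Embedding.nonempty_iff_card_le]
    simpa using hcard.le
  choose v hv using fun j : Fin (d + 1) =>
    hv ((univ.filter fun B => j ∈ B).image fun B => (e B : Finset V)) (by
      intro A hA
      obtain ⟨B, -, rfl⟩ := mem_image.1 hA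
      exact (e B).2)
  have hmem : ∀ j B, v j ∈ (e B : Finset V) ↔ j ∈ B := fun j B => by
    rw [hv j _ (e B).2]
    simp
  have hinj : Function.Injective v := fun i j hij => by
    have := (hmem i {j}).1 (hij ▸ (hmem j {j}).2 (mem_singleton_self j))
    simpa using this
  have hsh : F.Shatters (univ.image v) := by
    intro t ht
    refine ⟨e (univ.filter fun j => v j ∈ t), hF (e _).2, ?_⟩
    ext x
    constructor
    · intro hx
      obtain ⟨hx, hx'⟩ := mem_inter.1 hx
      obtain ⟨j, -, rfl⟩ := mem_image.1 hx
      simpa [hmem] using hx'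
    · intro hx
      obtain ⟨j, -, rfl⟩ := mem_image.1 (ht hx)
      simpa [hmem] using hx
  have := hsh.card_le_vcDim
  rw [card_image_of_injective _ hinj, card_univ, Fintype.card_fin] at this
  omega

/-- Any two members of `F` are nested or disjoint. -/
def IsLaminar (F : Finset (Finset V)) : Prop :=
  ∀ A ∈ F, ∀ B ∈ F, A ⊆ B ∨ B ⊆ A ∨ Disjoint A B

omit [Fintype V] in
theorem IsLaminar.vcDim_le {F : Finset (Finset V)} (hF : IsLaminar F) : F.vcDim ≤ 2 := by
  refine vcDim_le_of_forall fun s hs => ?_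
  by_contra! hcard
  obtain ⟨x, hx, y, hy, z, hz, hxy, hxz, hyz⟩ := two_lt_card.1 hcard
  obtain ⟨A, hA, hA'⟩ := @hs {x, y} (by grind)
  obtain ⟨B, hB, hB'⟩ := @hs {y, z} (by grind)
  rw [Finset.ext_iff] at hA' hB'
  have hxA : x ∈ A ∧ x ∉ B := by have := hA' x; have := hB' x; grind
  have hyA : y ∈ A ∧ y ∈ B := by have := hA' y; have := hB' y; grind
  have hzA : z ∉ A ∧ z ∈ B := by have := hA' z; have := hB' z; grind
  rcases hF A hA B hB with h | h | h
  · exact hxA.2 (h hxA.1)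
  · exact hzA.1 (h hzA.2)
  · exact Finset.disjoint_left.1 h hyA.1 hyA.2

theorem IsLaminar.dualVCDim_le {F : Finset (Finset V)} (hF : IsLaminar F) : dualVCDim F ≤ 1 := by
  refine vcDim_le_of_forall fun s hs => ?_
  by_contra! hcard
  obtain ⟨hsF, hv⟩ := exists_mem_iff_of_dualSystem_shatters hs
  obtain ⟨A, hA, B, hB, hAB⟩ := one_lt_card.1 hcard
  obtain ⟨x, hx⟩ := hv {A} (by grind)
  obtain ⟨y, hy⟩ := hv {B} (by grind)
  obtain ⟨z, hz⟩ := hv s Subset.rfl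
  rcases hF A (hsF hA) B (hsF hB) with h | h | h
  · grind
  · grind
  · exact Finset.disjoint_left.1 h ((hz A hA).2 hA) ((hz B hB).2 hB)

end Dual

/-- If every `y ∈ t` is related to at least a fraction `1 / q` of `s`, then some `x ∈ s` is related
to at least a fraction `1 / q` of `t`. -/
theorem exists_card_le_mul_card_filter {α β : Type*} {s : Finset α} {t : Finset β}
    (r : α → β → Prop) [∀ a b, Decidable (r a b)] {q : ℕ} (hs : s.Nonempty)
    (h : ∀ y ∈ t, #s ≤ q * #{x ∈ s | r x y}) : ∃ x ∈ s, #t ≤ q * #{y ∈ t | r x y} := by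
  by_contra! hc
  have h1 : ∑ x ∈ s, q * #{y ∈ t | r x y} < ∑ x ∈ s, #t := sum_lt_sum_of_nonempty hs hc
  have h2 : ∑ y ∈ t, #s ≤ ∑ y ∈ t, q * #{x ∈ s | r x y} := sum_le_sum h
  have h3 := sum_card_bipartiteAbove_eq_sum_card_bipartiteBelow (s := s) (t := t) r
  simp only [bipartiteAbove, bipartiteBelow] at h3
  rw [← mul_sum] at h1 h2
  rw [← h3] at h2
  simp only [sum_const, smul_eq_mul] at h1 h2
  linarith [mul_comm #s #t]

/-! ### Color lists and dominated subsets. -/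

section Core
variable {V K : Type*} [DecidableEq V] [DecidableEq K]

/-- The graphs `G i` partition the edges of the complete graph. -/
structure IsEdgePartition (G : K → SimpleGraph V) : Prop where
  cover : ∀ ⦃u v⦄, u ≠ v → ∃ i, (G i).Adj u v
  unique : ∀ ⦃u v i j⦄, (G i).Adj u v → (G j).Adj u v → i = j

variable (G : K → SimpleGraph V) [∀ i, DecidableRel (G i).Adj]

/-- The vertices of `U` joined to `v` by no color of `T`. -/
def missed (U : Finset V) (T : Finset K) (v : V) : Finset V :=
  {w ∈ U | w ≠ v ∧ ∀ i ∈ T, ¬ (G i).Adj v w}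

/-- Up to a fraction `1 / l` of all pairs, every vertex of `U` sends only `l` colors to `U`. -/
def HasLists (U : Finset V) (l : ℕ) : Prop :=
  ∃ L : V → Finset K, (∀ v, #(L v) ≤ l) ∧ l * ∑ v ∈ U, #(missed G U (L v) v) ≤ #U ^ 2

/-- The colors `i` for which some `w ∈ W` having `i` in its list is joined to `v` by color `i`. -/
def seen (L : V → Finset K) (W : Finset V) (v : V) : Finset K :=
  W.biUnion fun w => {i ∈ L w | (G i).Adj w v}

/-- Every color of `T` joins some vertex of `U` to all of `S`. -/
def Dominated (U S : Finset V) (T : Finset K) : Prop :=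
  ∀ i ∈ T, ∃ w ∈ U, ∀ s ∈ S, (G i).Adj w s

/-- The number of traces of vertices on a set `P` of colored neighborhoods is at most
`(#P + 1) ^ d`. -/
def HasTraceBound [Fintype V] (d : ℕ) : Prop :=
  ∀ P : Finset (K × V), #(univ.image fun v => {p ∈ P | (G p.1).Adj p.2 v}) ≤ (#P + 1) ^ d

variable {G}

omit [DecidableEq K] in
theorem mem_missed {U : Finset V} {T : Finset K} {v w : V} :
    w ∈ missed G U T v ↔ w ∈ U ∧ w ≠ v ∧ ∀ i ∈ T, ¬ (G i).Adj v w :=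
  mem_filter

/-- Greedy choice with potential ∑ (t - #seen). While more than half of `B` is unfinished, averaging
gives a vertex of `U` showing a new color to 1/q of the unfinished vertices, so the potential drops
by at least #B/(2q). -/
theorem exists_seen_of_richness {U B : Finset V} {L : V → Finset K} {q t : ℕ} (hU : U.Nonempty)
    (hB : ∀ v ∈ B, ∀ T : Finset K, #T ≤ t →
      #U ≤ q * #{w ∈ U | ∃ i ∈ L w, i ∉ T ∧ (G i).Adj w v}) (h : ℕ) :
    ∃ W ⊆ U, #W ≤ h ∧ (#B ≤ 2 * #{v ∈ B | t ≤ #(seen G L W v)} ∨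
      2 * q * ∑ v ∈ B, (t - #(seen G L W v)) + h * #B ≤ 2 * q * t * #B) := by
  induction h with
  | zero => exact ⟨∅, by simp, by simp, Or.inr (by simp [seen]; linarith)⟩
  | succ h ih =>
    obtain ⟨W, hWU, hW, hfin | hpot⟩ := ih
    · exact ⟨W, hWU, by omega, Or.inl hfin⟩
    by_cases hfin : #B ≤ 2 * #{v ∈ B | t ≤ #(seen G L W v)}
    · exact ⟨W, hWU, by omega, Or.inl hfin⟩
    set X := {v ∈ B | ¬ t ≤ #(seen G L W v)} with hX
    have hcard : #{v ∈ B | t ≤ #(seen G L W v)} + #X = #B := card_filter_add_card_filter_not _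
    obtain ⟨w, hw, hwX⟩ := exists_card_le_mul_card_filter (s := U) (t := X)
      (fun w v => ∃ i ∈ L w, i ∉ seen G L W v ∧ (G i).Adj w v) (q := q) hU (fun v hv => by
        obtain ⟨hv, hv'⟩ := mem_filter.1 hv
        exact hB v hv _ (by omega))
    refine ⟨insert w W, insert_subset hw hWU, (card_insert_le _ _).trans (by omega), Or.inr ?_⟩
    have hsub : ∀ v, seen G L W v ⊆ seen G L (insert w W) v := fun v =>
      biUnion_subset_biUnion_of_subset_left _ (subset_insert _ _)
    -- Vertices of `X` have seen fewer than t colors, so the truncated difference really drops for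
    -- them.
    have hdec : ∑ v ∈ B, (t - #(seen G L (insert w W) v)) +
        #{v ∈ X | ∃ i ∈ L w, i ∉ seen G L W v ∧ (G i).Adj w v} ≤
        ∑ v ∈ B, (t - #(seen G L W v)) := by
      rw [hX, filter_filter, card_filter, ← sum_add_distrib]
      refine sum_le_sum fun v _ => ?_
      have h1 := card_le_card (hsub v)
      split_ifs with hv
      · obtain ⟨hvt, i, hi, hi', hadj⟩ := hv
        have : #(seen G L W v) < #(seen G L (insert w W) v) := by
          refine card_lt_card (Finset.ssubset_iff_subset_ne.2 ⟨hsub v, fun heq => hi' ?_⟩)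
          rw [heq]
          exact mem_biUnion.2 ⟨w, mem_insert_self _ _, mem_filter.2 ⟨hi, hadj⟩⟩
        omega
      · omega
    have h2 : #B ≤ 2 * #X := by omega
    nlinarith [Nat.mul_le_mul_left (2 * q) hdec]

/-- Vertices with the same trace on the listed neighborhoods of `W` see the same colors through the
same vertices of `W`; S is the most popular trace class. -/
theorem exists_dominated_of_seen [Fintype V] {d : ℕ} (hd : HasTraceBound G d) {U W B : Finset V}
    {L : V → Finset K} {l t : ℕ} (hL : ∀ v, #(L v) ≤ l) (hW : W ⊆ U) (hB : B ⊆ U)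
    (hne : B.Nonempty) (ht : ∀ v ∈ B, t ≤ #(seen G L W v)) :
    ∃ (T : Finset K) (S : Finset V), S ⊆ U ∧ Dominated G U S T ∧ t ≤ #T ∧
      #B ≤ (#W * l + 1) ^ d * #S := by
  set P : Finset (K × V) := W.biUnion fun w => (L w).image fun i => (i, w) with hP
  set φ : V → Finset (K × V) := fun v => {p ∈ P | (G p.1).Adj p.2 v} with hφ
  have hPcard : #P ≤ #W * l :=
    card_biUnion_le_card_mul _ _ _ fun w _ => card_image_le.trans (hL w)
  obtain ⟨v, hv, hmax⟩ := exists_max_image B (fun v => #{u ∈ B | φ u = φ v}) hne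
  refine ⟨seen G L W v, {u ∈ B | φ u = φ v}, (filter_subset _ _).trans hB, ?_, ht v hv, ?_⟩
  · intro i hi
    obtain ⟨w, hw, hi⟩ := mem_biUnion.1 hi
    obtain ⟨hi, hadj⟩ := mem_filter.1 hi
    refine ⟨w, hW hw, fun u hu => ?_⟩
    have hmem : (i, w) ∈ φ v :=
      mem_filter.2 ⟨mem_biUnion.2 ⟨w, hw, mem_image_of_mem _ hi⟩, hadj⟩
    rw [← (mem_filter.1 hu).2] at hmem
    exact (mem_filter.1 hmem).2
  · have h1 : #B ≤ #{u ∈ B | φ u = φ v} * #(B.image φ) := by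
      refine card_le_mul_card_image B _ fun a ha => ?_
      obtain ⟨u, hu, rfl⟩ := mem_image.1 ha
      exact hmax u hu
    have h2 : #(B.image φ) ≤ (#W * l + 1) ^ d :=
      (card_le_card (image_subset_image (subset_univ B))).trans
        ((hd P).trans (Nat.pow_le_pow_left (by omega) d))
    calc #B ≤ _ := h1
      _ ≤ #{u ∈ B | φ u = φ v} * (#W * l + 1) ^ d := Nat.mul_le_mul_left _ h2
      _ = _ := mul_comm _ _

/-- Long lists can be shortened, unless there is a large subset dominated in many colors. -/
theorem HasLists.shorten [Fintype V] (hG : IsEdgePartition G) {d : ℕ} (hd : HasTraceBound G d)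
    {U : Finset V} (hU : U.Nonempty) {l t : ℕ} (hl : 16 * t ^ 2 ≤ l)
    (h : HasLists G U l) :
    HasLists G U t ∨ ∃ (T : Finset K) (S : Finset V), S ⊆ U ∧ Dominated G U S T ∧ t ≤ #T ∧
      #U ≤ 8 * t * ((8 * t ^ 2 + 1) * l + 1) ^ d * #S := by
  classical
  obtain ⟨L, hL, hLU⟩ := h
  have hN : 0 < #U := hU.card_pos
  -- If at most 1/(2t) of `U` is bad, all pairs at bad vertices plus 1/(2t) of the others fit in the
  -- budget 1/t.
  set bad := {v ∈ U | ∀ T : Finset K, #T ≤ t → #U < 2 * t * #(missed G U T v)} with hbad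
  by_cases hb : 2 * t * #bad ≤ #U
  · left
    have hch : ∀ v, ∃ T : Finset K, #T ≤ t ∧ (v ∈ U → v ∉ bad →
        2 * t * #(missed G U T v) ≤ #U) := fun v => by
      by_cases hv : v ∈ U ∧ v ∉ bad
      · have : ¬ ∀ T : Finset K, #T ≤ t → #U < 2 * t * #(missed G U T v) := fun h =>
          hv.2 (mem_filter.2 ⟨hv.1, h⟩)
        push Not at this
        obtain ⟨T, hT, hT'⟩ := this
        exact ⟨T, hT, fun _ _ => hT'⟩
      · exact ⟨∅, by simp, fun h1 h2 => (hv ⟨h1, h2⟩).elim⟩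
    choose L' hL' hL'U using hch
    refine ⟨L', hL', ?_⟩
    have h1 : ∑ v ∈ U, 2 * t * #(missed G U (L' v) v) ≤
        ∑ v ∈ U, (#U + if v ∈ bad then 2 * t * #U else 0) := by
      refine sum_le_sum fun v hv => ?_
      split_ifs with hvb
      · exact le_add_left (Nat.mul_le_mul_left _ (card_le_card (filter_subset _ _)))
      · simpa using hL'U v hv hvb
    have hbU : bad ⊆ U := filter_subset _ _
    rw [← mul_sum, sum_add_distrib, ← sum_filter, filter_mem_eq_inter,
      inter_eq_right.2 hbU] at h1
    simp only [sum_const, smul_eq_mul] at h1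
    nlinarith [Nat.mul_le_mul_right #U hb]
  · right
    push Not at hb
    -- These are the w whose own list omits the color of wv. Since l ≥ 16t², at most #U/(4t)
    -- vertices have more than #U/(4t) such w; the other bad vertices form `B`.
    set star : V → Finset V := fun v => {w ∈ U | v ≠ w ∧ ∀ i ∈ L w, ¬ (G i).Adj w v} with hstar
    have hsum : ∑ v ∈ U, #(star v) = ∑ w ∈ U, #(missed G U (L w) w) :=
      (sum_card_bipartiteAbove_eq_sum_card_bipartiteBelow (s := U) (t := U)
        (fun w v => v ≠ w ∧ ∀ i ∈ L w, ¬ (G i).Adj w v)).symm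
    rw [← hsum] at hLU
    set H := {v ∈ bad | #U < 4 * t * #(star v)} with hH
    set B := {v ∈ bad | ¬ #U < 4 * t * #(star v)} with hBdef
    have hHB : #H + #B = #bad := card_filter_add_card_filter_not _
    have hHcard : 4 * t * #H ≤ #U := by
      have h1 : #H * #U ≤ 4 * t * ∑ v ∈ U, #(star v) := by
        rw [mul_sum]
        calc #H * #U ≤ ∑ v ∈ H, 4 * t * #(star v) := by
              rw [← smul_eq_mul]
              exact card_nsmul_le_sum _ _ _ fun v hv => (mem_filter.1 hv).2.le
          _ ≤ _ := sum_le_sum_of_subset ((filter_subset _ _).trans (filter_subset _ _))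
      have h2 : 16 * t ^ 2 * ∑ v ∈ U, #(star v) ≤ #U ^ 2 :=
        (Nat.mul_le_mul_right _ hl).trans hLU
      have h3 : 4 * t * #H * #U ≤ #U * #U := by nlinarith
      exact Nat.le_of_mul_le_mul_right h3 hN
    have hBcard : #U ≤ 4 * t * #B := by nlinarith
    have hBpos : 0 < #B := Nat.pos_of_ne_zero fun h0 => by rw [h0] at hBcard; omega
    have hBU : B ⊆ U := (filter_subset _ _).trans (filter_subset _ _)
    have hrich : ∀ v ∈ B, ∀ T : Finset K, #T ≤ t →
        #U ≤ (4 * t) * #{w ∈ U | ∃ i ∈ L w, i ∉ T ∧ (G i).Adj w v} := by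
      intro v hv T hT
      obtain ⟨hvb, hvs⟩ := mem_filter.1 hv
      have h1 := (mem_filter.1 hvb).2 T hT
      have h2 : missed G U T v ⊆ star v ∪ {w ∈ U | ∃ i ∈ L w, i ∉ T ∧ (G i).Adj w v} := by
        intro w hw
        obtain ⟨hwU, hwv, hwT⟩ := mem_filter.1 hw
        obtain ⟨i, hi⟩ := hG.cover hwv
        by_cases hiL : i ∈ L w
        · exact mem_union_right _ (mem_filter.2 ⟨hwU, i, hiL, fun hiT => hwT i hiT hi.symm, hi⟩)
        · refine mem_union_left _ (mem_filter.2 ⟨hwU, hwv.symm, fun j hj hadj => hiL ?_⟩)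
          rwa [hG.unique hi hadj]
      have h3 := (card_le_card h2).trans (card_union_le _ _)
      nlinarith [Nat.mul_le_mul_left (4 * t) h3]
    -- With q = 4t the potential allows 2qt = 8t² rounds, so one more is impossible.
    obtain ⟨W, hWU, hW, hfin | hpot⟩ := exists_seen_of_richness hU hrich (8 * t ^ 2 + 1)
    · have hne : {v ∈ B | t ≤ #(seen G L W v)}.Nonempty := card_pos.1 (by omega)
      obtain ⟨T, S, hSU, hST, hT, hcard⟩ := exists_dominated_of_seen hd hL hWU
        ((filter_subset _ _).trans hBU) hne (fun v hv => (mem_filter.1 hv).2)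
      refine ⟨T, S, hSU, hST, hT, ?_⟩
      calc #U ≤ 4 * t * #B := hBcard
        _ ≤ 4 * t * (2 * ((#W * l + 1) ^ d * #S)) :=
          Nat.mul_le_mul_left _ (hfin.trans (Nat.mul_le_mul_left _ hcard))
        _ ≤ 4 * t * (2 * (((8 * t ^ 2 + 1) * l + 1) ^ d * #S)) := by gcongr
        _ = _ := by ring
    · exfalso
      nlinarith [Nat.zero_le (2 * (4 * t) * ∑ v ∈ B, (t - #(seen G L W v)))]

theorem sixteen_mul_sq_le_two_pow {t : ℕ} (ht : 16 ≤ t) : 16 * t ^ 2 ≤ 2 ^ t := by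
  induction t, ht using Nat.le_induction with
  | base => norm_num
  | succ t ht ih => rw [pow_succ 2 t]; nlinarith

/-- The loss of one shortening from 2^t to t is a constant factor for each of the t colors gained.
-/
theorem shortening_loss_le {t : ℕ} (ht : 16 ≤ t) (d : ℕ) :
    8 * t * ((8 * t ^ 2 + 1) * 2 ^ t + 1) ^ d ≤ (2 ^ (3 * d + 6)) ^ t := by
  have h1 := sixteen_mul_sq_le_two_pow ht
  have h2 : (8 * t ^ 2 + 1) * 2 ^ t + 1 ≤ 2 ^ (3 * t) := by
    have : 2 ^ (3 * t) = 2 ^ t * 2 ^ t * 2 ^ t := by ring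
    rw [this]
    have h3 : 8 * t ^ 2 + 2 ≤ 2 ^ t := by nlinarith
    have h4 : 1 ≤ 2 ^ t := Nat.one_le_two_pow
    nlinarith [Nat.mul_le_mul_right (2 ^ t) h3, Nat.mul_le_mul_left (2 ^ t * 2 ^ t) h4]
  have h5 : 8 * t ≤ 2 ^ (6 * t) :=
    le_trans (by nlinarith : 8 * t ≤ 2 ^ t) (Nat.pow_le_pow_right (by norm_num) (by omega))
  calc 8 * t * ((8 * t ^ 2 + 1) * 2 ^ t + 1) ^ d ≤ 2 ^ (6 * t) * (2 ^ (3 * t)) ^ d := by gcongr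
    _ = _ := by rw [← pow_mul, ← pow_mul, ← pow_add]; congr 1; ring

/-- The tower of twos on top of `16`. -/
def tower (j : ℕ) : ℕ := (fun x => 2 ^ x)^[j] 16

theorem tower_succ (j : ℕ) : tower (j + 1) = 2 ^ tower j :=
  Function.iterate_succ_apply' _ _ _

theorem le_tower (j : ℕ) : j + 16 ≤ tower j := by
  induction j with
  | zero => simp [tower]
  | succ j ih =>
    rw [tower_succ]
    have := (tower j).lt_two_pow_self
    omega

omit [DecidableEq K] in
theorem exists_dominated_of_hasLists_sixteen {U : Finset V}
    (hU : 2 ≤ #U) (h : HasLists G U 16) :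
    ∃ (i : K) (S : Finset V), S ⊆ U ∧ Dominated G U S {i} ∧ #U ≤ 64 * #S := by
  obtain ⟨L, hL, hLU⟩ := h
  have hne : U.Nonempty := card_pos.1 (by omega)
  obtain ⟨v, hv, hvm⟩ : ∃ v ∈ U, 16 * #(missed G U (L v) v) ≤ #U := by
    by_contra! hc
    have := sum_lt_sum_of_nonempty hne hc
    rw [← mul_sum, sum_const, smul_eq_mul] at this
    nlinarith
  have hcov : U.erase v ⊆ missed G U (L v) v ∪ (L v).biUnion fun i => {w ∈ U | (G i).Adj v w} := by
    intro w hw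
    obtain ⟨hwv, hwU⟩ := mem_erase.1 hw
    by_cases hex : ∃ i ∈ L v, (G i).Adj v w
    · obtain ⟨i, hi, hadj⟩ := hex
      exact mem_union_right _ (mem_biUnion.2 ⟨i, hi, mem_filter.2 ⟨hwU, hadj⟩⟩)
    · push Not at hex
      exact mem_union_left _ (mem_filter.2 ⟨hwU, hwv, hex⟩)
  have hcard := (card_le_card hcov).trans (card_union_le _ _)
  rw [card_erase_of_mem hv] at hcard
  by_contra! hc
  have hsmall : ∀ i, 64 * #{w ∈ U | (G i).Adj v w} < #U := fun i =>
    hc i _ (filter_subset _ _) fun j hj =>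
      ⟨v, hv, fun s hs => by rw [mem_singleton.1 hj]; exact (mem_filter.1 hs).2⟩
  have h16 : 64 * #((L v).biUnion fun i => {w ∈ U | (G i).Adj v w}) ≤ 16 * #U := by
    calc _ ≤ 64 * ∑ i ∈ L v, #{w ∈ U | (G i).Adj v w} := Nat.mul_le_mul_left _ card_biUnion_le
      _ ≤ ∑ i ∈ L v, #U := by rw [mul_sum]; exact sum_le_sum fun i _ => (hsmall i).le
      _ ≤ 16 * #U := by rw [sum_const, smul_eq_mul]; exact Nat.mul_le_mul_right _ (hL v)
  -- Otherwise #U - 1 ≤ #U/16 + #U/4, which fails for #U ≥ 2.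
  omega

/-- Some large subset is dominated in a nonempty set of colors, losing only a constant factor for
each of these colors. -/
theorem exists_dominated [Fintype V] [Fintype K] (hG : IsEdgePartition G) {d : ℕ}
    (hd : HasTraceBound G d) {U : Finset V} (hU : 2 ≤ #U) :
    ∃ (T : Finset K) (S : Finset V), T.Nonempty ∧ S ⊆ U ∧ Dominated G U S T ∧
      #U ≤ (2 ^ (3 * d + 6)) ^ #T * #S := by
  have hne : U.Nonempty := card_pos.1 (by omega)
  by_contra! hc
  have hlists : ∀ j, HasLists G U (tower j) → HasLists G U 16 := by
    intro j
    induction j with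
    | zero => exact id
    | succ j ih =>
      intro h
      have htj : 16 ≤ tower j := by have := le_tower j; omega
      rw [tower_succ] at h
      obtain h | ⟨T, S, hSU, hST, hT, hcard⟩ :=
        h.shorten hG hd hne (sixteen_mul_sq_le_two_pow htj)
      · exact ih h
      · refine absurd (hc T S (card_pos.1 (by omega)) hSU hST) (not_lt.2 ?_)
        calc #U ≤ _ := hcard
          _ ≤ (2 ^ (3 * d + 6)) ^ tower j * #S :=
            Nat.mul_le_mul_right _ (shortening_loss_le htj d)
          _ ≤ _ := Nat.mul_le_mul_right _ (Nat.pow_le_pow_right (by positivity) hT)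
  -- A tower this high exceeds the number of colors, so full lists miss nothing.
  have htop : HasLists G U (tower (Fintype.card K)) := by
    refine ⟨fun _ => univ, fun _ => ?_, ?_⟩
    · have := le_tower (Fintype.card K)
      rw [card_univ]
      omega
    · have : ∀ v, missed G U univ v = ∅ := fun v => by
        refine eq_empty_of_forall_notMem fun w hwm => ?_
        obtain ⟨-, hwv, hw⟩ := mem_missed.1 hwm
        obtain ⟨i, hi⟩ := hG.cover hwv
        exact hw i (mem_univ i) hi.symm
      simp only [this, card_empty, sum_const_zero, mul_zero, zero_le]
  obtain ⟨i, S, hSU, hST, hcard⟩ := exists_dominated_of_hasLists_sixteen hU (hlists _ htop)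
  have := hc {i} S (singleton_nonempty i) hSU hST
  have h64 : 64 ≤ 2 ^ (3 * d + 6) := by
    rw [pow_add]
    have : 1 ≤ 2 ^ (3 * d) := Nat.one_le_two_pow
    omega
  rw [card_singleton, pow_one] at this
  have := Nat.mul_le_mul_right #S h64
  omega

/-- A vertex set whose cliques of color `i` have at most `a i` vertices has size at most
exponential in `∑ i, a i`. -/
theorem card_le_pow_of_cliqueFreeOn [Fintype V] [Fintype K] (hG : IsEdgePartition G) {d : ℕ}
    (hd : HasTraceBound G d) (a : K → ℕ) (U : Finset V)
    (h : ∀ i, (G i).CliqueFreeOn U (a i + 1)) : #U ≤ (2 ^ (3 * d + 6)) ^ ∑ i, a i := by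
  induction hs : ∑ i, a i using Nat.strong_induction_on generalizing a U with
  | _ s ih =>
    subst hs
    by_cases hU : 2 ≤ #U
    · obtain ⟨T, S, hT, hSU, hST, hcard⟩ := exists_dominated hG hd hU
      have hpos : ∀ i ∈ T, 1 ≤ a i := by
        intro i hi
        by_contra! h0
        obtain ⟨w, hw, -⟩ := hST i hi
        have := h i (t := {w}) (by simpa using hw)
        rw [Nat.lt_one_iff.1 h0] at this
        exact this (by simp [SimpleGraph.isNClique_iff])
      have hsum : ∑ i, (a i - if i ∈ T then 1 else 0) + #T = ∑ i, a i := by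
        have h1 : #T = ∑ i, if i ∈ T then 1 else 0 := by simp
        rw [h1, ← sum_add_distrib]
        refine sum_congr rfl fun i _ => ?_
        split_ifs with hi
        · have := hpos i hi
          omega
        · simp
      have hTpos := hT.card_pos
      have hS := ih _ (by omega) (fun i => a i - if i ∈ T then 1 else 0) S (fun i => by
        by_cases hi : i ∈ T
        · obtain ⟨w, hw, hwS⟩ := hST i hi
          have hai := hpos i hi
          have h1 := (h i).of_succ (G i) (mem_coe.2 hw)
          simp only [hi, if_true, Nat.sub_add_cancel hai]
          have hSw : (S : Set V) ⊆ ↑U ∩ (G i).neighborSet w := fun s hs => ⟨hSU hs, hwS s hs⟩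
          exact h1.subset (G i) hSw
        · simpa [hi] using (h i).subset (G i) (coe_subset.2 hSU)) rfl
      calc #U ≤ _ := hcard
        _ ≤ _ := Nat.mul_le_mul_left _ hS
        _ = _ := by rw [← pow_add, add_comm #T, hsum]
    · exact (by omega : #U ≤ 1).trans (Nat.one_le_pow _ _ (by positivity))

end Core

/-! ### From dual VC-dimension to monochromatic cliques. -/

section Upper
variable {n m : ℕ} (χ : Coloring n m)

theorem isEdgePartition_labelGraph : IsEdgePartition fun i => χ.labelGraph i where
  cover u v h := ⟨χ.get u v h, by simpa using h⟩
  unique u v i j hi hj := by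
    obtain ⟨h, rfl⟩ := (SimpleGraph.TopEdgeLabeling.labelGraph_adj u v).1 hi
    obtain ⟨-, rfl⟩ := (SimpleGraph.TopEdgeLabeling.labelGraph_adj u v).1 hj
    rfl

variable {χ}

theorem hasTraceBound_of_dualVCDim_le {d : ℕ} (hd : dualVCDim (nbhdSystem χ) ≤ d) :
    HasTraceBound (fun i => χ.labelGraph i) d := by
  intro P
  set N : Fin m × Fin n → Finset (Fin n) := fun p => (χ.labelGraph p.1).neighborFinset p.2
  have h1 : (univ.image fun v => {p ∈ P | (χ.labelGraph p.1).Adj p.2 v}) ⊆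
      ((dualSystem (nbhdSystem χ)).image fun A => P.image N ∩ A).image
        fun T => {p ∈ P | N p ∈ T} := by
    refine image_subset_iff.2 fun v _ => mem_image.2 ⟨_, mem_image_of_mem _
      (mem_image_of_mem _ (mem_univ v)), ?_⟩
    refine filter_congr fun p hp => ?_
    have hNF : N p ∈ nbhdSystem χ := mem_image_of_mem _ (mem_univ p)
    have hNP : N p ∈ P.image N := mem_image_of_mem _ hp
    simp only [mem_inter, hNP, mem_filter, hNF, true_and]
    exact SimpleGraph.mem_neighborFinset _ _ _
  calc _ ≤ _ := card_le_card h1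
    _ ≤ _ := card_image_le
    _ ≤ _ := card_trace_le _ _ hd
    _ ≤ _ := Nat.pow_le_pow_left (Nat.succ_le_succ card_image_le) d

theorem hasMonoClique_of_dualVCDim_le {d k : ℕ} (hk : 1 ≤ k)
    (hd : dualVCDim (nbhdSystem χ) ≤ d) (hn : (2 ^ (3 * d + 6)) ^ (m * (k - 1)) < n) :
    HasMonoClique χ k := by
  by_contra hno
  refine absurd (card_le_pow_of_cliqueFreeOn (isEdgePartition_labelGraph χ)
    (hasTraceBound_of_dualVCDim_le hd) (fun _ => k - 1) univ fun i S _ hS => hno ⟨i, S, ?_⟩)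
    (by simpa using hn)
  rwa [Nat.sub_add_cancel hk] at hS

end Upper

/-! ### The binary cube coloring. -/

section Lower

/-- The highest binary digit in which `x` and `y` differ is the digit `i`. -/
def SplitAt (i x y : ℕ) : Prop := x / 2 ^ (i + 1) = y / 2 ^ (i + 1) ∧ x / 2 ^ i ≠ y / 2 ^ i

theorem div_two_pow_eq_of_le {i j x y : ℕ} (hij : i ≤ j) (h : x / 2 ^ i = y / 2 ^ i) :
    x / 2 ^ j = y / 2 ^ j := by
  obtain ⟨k, rfl⟩ := Nat.exists_eq_add_of_le hij
  rw [pow_add, ← Nat.div_div_eq_div_mul, h, Nat.div_div_eq_div_mul]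

theorem SplitAt.symm {i x y : ℕ} (h : SplitAt i x y) : SplitAt i y x := ⟨h.1.symm, h.2.symm⟩

theorem SplitAt.unique {i j x y : ℕ} (hi : SplitAt i x y) (hj : SplitAt j x y) : i = j := by
  rcases lt_trichotomy i j with h | h | h
  · exact (hj.2 (div_two_pow_eq_of_le h hi.1)).elim
  · exact h
  · exact (hi.2 (div_two_pow_eq_of_le h hj.1)).elim

/-- A binary digit has only two values. Hence the neighbors of x in color i lie in one dyadic block
of length 2^i, which excludes triangles. -/
theorem SplitAt.div_eq {i x y z : ℕ} (hy : SplitAt i x y) (hz : SplitAt i x z) :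
    y / 2 ^ i = z / 2 ^ i := by
  obtain ⟨hy, hy'⟩ := hy
  obtain ⟨hz, hz'⟩ := hz
  rw [pow_succ, ← Nat.div_div_eq_div_mul, ← Nat.div_div_eq_div_mul] at hy hz
  omega

theorem SplitAt.congr_right {i x y z : ℕ} (hy : SplitAt i x y) (h : y / 2 ^ i = z / 2 ^ i) :
    SplitAt i x z :=
  ⟨hy.1.trans (div_two_pow_eq_of_le (Nat.le_succ i) h), h ▸ hy.2⟩

theorem exists_splitAt {m x y : ℕ} (hx : x < 2 ^ m) (hy : y < 2 ^ m) (h : x ≠ y) :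
    ∃ i < m, SplitAt i x y := by
  have hex : ∃ j, x / 2 ^ j = y / 2 ^ j :=
    ⟨m, by rw [Nat.div_eq_of_lt hx, Nat.div_eq_of_lt hy]⟩
  classical
  have hle : Nat.find hex ≤ m :=
    Nat.find_min' hex (by rw [Nat.div_eq_of_lt hx, Nat.div_eq_of_lt hy])
  rcases hi : Nat.find hex with _ | i
  · have := Nat.find_spec hex
    rw [hi] at this
    simp [h] at this
  · refine ⟨i, by omega, ?_, Nat.find_min hex (by omega)⟩
    have := Nat.find_spec hex
    rwa [hi] at this

/-- Coloring the edges of the binary cube by the first digit in which the ends differ. -/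
theorem exists_laminar_coloring {n m : ℕ} (hn : n ≤ 2 ^ m) :
    ∃ χ : Coloring n m, IsLaminar (nbhdSystem χ) ∧ ¬ HasMonoClique χ 3 := by
  have hex : ∀ x y : Fin n, x ≠ y → ∃ i : Fin m, SplitAt i x y := fun x y h => by
    obtain ⟨i, hi, hs⟩ := exists_splitAt (x.2.trans_le hn) (y.2.trans_le hn) (Fin.val_ne_of_ne h)
    exact ⟨⟨i, hi⟩, hs⟩
  choose f hf using hex
  let χ : Coloring n m := SimpleGraph.EdgeLabeling.mk (fun x y h => f x y h)
    fun x y h => Fin.ext ((hf y x h.symm).symm.unique (hf x y h))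
  have hadj : ∀ i x y, (χ.labelGraph i).Adj x y ↔ SplitAt i x y := fun i x y => by
    rw [SimpleGraph.TopEdgeLabeling.labelGraph_adj]
    constructor
    · rintro ⟨h, rfl⟩
      exact hf x y h
    · intro h
      have hxy : x ≠ y := fun hxy => h.2 (by rw [hxy])
      exact ⟨hxy, Fin.ext ((hf x y hxy).unique h)⟩
  refine ⟨χ, ?_, ?_⟩
  · have key : ∀ (i j : Fin m) (u v : Fin n), i ≤ j →
        (χ.labelGraph i).neighborFinset u ⊆ (χ.labelGraph j).neighborFinset v ∨
        Disjoint ((χ.labelGraph i).neighborFinset u) ((χ.labelGraph j).neighborFinset v) := by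
      intro i j u v hij
      by_contra! hc
      obtain ⟨hsub, hdis⟩ := hc
      obtain ⟨w, hw, hw'⟩ := not_disjoint_iff.1 hdis
      refine hsub fun z hz => ?_
      rw [SimpleGraph.mem_neighborFinset, hadj] at hw hw' hz ⊢
      exact hw'.congr_right (div_two_pow_eq_of_le hij (hw.div_eq hz))
    intro A hA B hB
    obtain ⟨⟨i, u⟩, -, rfl⟩ := mem_image.1 hA
    obtain ⟨⟨j, v⟩, -, rfl⟩ := mem_image.1 hB
    rcases le_total i j with hij | hij
    · exact (key i j u v hij).imp_right Or.inr
    · exact Or.inr ((key j i v u hij).imp_right fun h => h.symm)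
  · rintro ⟨i, S, hS⟩
    obtain ⟨x, y, z, hxy, hxz, hyz, -⟩ := SimpleGraph.is3Clique_iff.1 hS
    rw [hadj] at hxy hxz hyz
    exact hyz.2 (hxy.div_eq hxz)

end Lower

theorem two_pow_lt_iInf {P : ℕ → Prop} {m : ℕ} (h : ∀ n ≤ 2 ^ m, ¬ P n) :
    (2 : ℕ∞) ^ m < ⨅ n ∈ {n : ℕ | P n}, (n : ℕ∞) := by
  have h1 : ((2 ^ m + 1 : ℕ) : ℕ∞) ≤ ⨅ n ∈ {n : ℕ | P n}, (n : ℕ∞) := by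
    refine le_iInf₂ fun n hn => Nat.cast_le.2 ?_
    by_contra! hlt
    exact h n (by omega) hn
  refine lt_of_lt_of_le ?_ h1
  exact_mod_cast Nat.lt_succ_self (2 ^ m)

theorem two_pow_lt_ramseyDualVC {d m : ℕ} (hd : 1 ≤ d) : 2 ^ m < ramseyDualVC d 3 m :=
  two_pow_lt_iInf fun _ hn hP =>
    have ⟨χ, hχ, hno⟩ := exists_laminar_coloring hn
    hno (hP χ (hχ.dualVCDim_le.trans hd))

theorem two_pow_lt_ramseyVC {d m : ℕ} (hd : 2 ≤ d) : 2 ^ m < ramseyVC d 3 m :=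
  two_pow_lt_iInf fun _ hn hP =>
    have ⟨χ, hχ, hno⟩ := exists_laminar_coloring hn
    hno (hP χ (hχ.vcDim_le.trans hd))

theorem hasMonoClique_two_pow {d k m : ℕ} (hk : 1 ≤ k) (hm : 1 ≤ m)
    (χ : Coloring (2 ^ (((3 * d + 6) * (k - 1) + 1) * m)) m)
    (hd : dualVCDim (nbhdSystem χ) ≤ d) : HasMonoClique χ k := by
  refine hasMonoClique_of_dualVCDim_le hk hd ?_
  rw [← pow_mul]
  refine Nat.pow_lt_pow_right (by norm_num) ?_
  -- The extra summand m ≥ 1 makes the inequality strict.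
  have : ((3 * d + 6) * (k - 1) + 1) * m = (3 * d + 6) * (m * (k - 1)) + m := by ring
  omega

theorem iInf_le_two_pow {P : ℕ → Prop} {e : ℕ} (h : P (2 ^ e)) :
    ⨅ n ∈ {n : ℕ | P n}, (n : ℕ∞) ≤ 2 ^ e :=
  (iInf₂_le (2 ^ e) h).trans (by simp)

end SchurErdos
open SchurErdos in
theorem theorem1 :
    (∀ k d : ℕ, 3 ≤ k → 2 ≤ d → ∃ c : ℕ, ∀ m : ℕ, 1 ≤ m →
      ramseyDualVC d k m ≤ 2 ^ (c * m) ∧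
      ∀ χ : Coloring (2 ^ (c * m)) m, dualVCDim (nbhdSystem χ) ≤ d → HasMonoClique χ k) ∧
    (∀ d : ℕ, 2 ≤ d → ∃ c : ℕ, ∀ m : ℕ, 1 ≤ m →
      (2 ^ m < ramseyDualVC d 3 m ∧ ramseyDualVC d 3 m ≤ 2 ^ (c * m)) ∧
      (2 ^ m < ramseyVC d 3 m ∧ ramseyVC d 3 m ≤ 2 ^ (c * m))) := by
  refine ⟨fun k d hk _ => ⟨(3 * d + 6) * (k - 1) + 1, fun m hm => ?_⟩,
    fun d hd => ⟨(3 * 2 ^ (d + 1) + 6) * (3 - 1) + 1, fun m hm => ?_⟩⟩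
  · have h := hasMonoClique_two_pow (d := d) (k := k) (m := m) (by omega) hm
    exact ⟨iInf_le_two_pow h, h⟩
  -- Dual bound 2^(d+1) serves both cases: it exceeds d, and VC-dimension at most d implies it.
  · have h := hasMonoClique_two_pow (d := 2 ^ (d + 1)) (k := 3) (m := m) (by omega) hm
    have hd' : d ≤ 2 ^ (d + 1) := (Nat.le_succ d).trans (Nat.lt_two_pow_self).le
    exact ⟨⟨two_pow_lt_ramseyDualVC (by omega), iInf_le_two_pow fun χ hχ => h χ (hχ.trans hd')⟩,
      two_pow_lt_ramseyVC hd, iInf_le_two_pow fun χ hχ => h χ (dualVCDim_le_two_pow hχ)⟩
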